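/- Let $d\ge 0$ be an integer and let $\mathbb{Q}(v)$ be the field of rational functions in an indeterminate $v$. Let $\mathbf{U}=\mathbf{U}_v(\mathfrak{gl}_2)$ be the $\mathbb{Q}(v)$-algebra with generators $e,f,K_1^{\pm1},K_2^{\pm1}$ and relations $K_1K_2=K_2K_1$, $K_iK_i^{-1}=K_i^{-1}K_i=1$ $(i=1,2)$, $K_1eK_1^{-1}=ve$, $K_1fK_1^{-1}=v^{-1}f$, $K_2eK_2^{-1}=v^{-1}e$, $K_2fK_2^{-1}=vf$, $ef-fe=\dfrac{K_1K_2^{-1}-K_1^{-1}K_2}{v-v^{-1}}$. It is a bialgebra with comultiplication $\Delta(e)=e\otimes 1+K_1K_2^{-1}\otimes e$, $\Delta(f)=f\otimes K_1^{-1}K_2+1\otimes f$, $\Delta(K_i^{\pm1})=K_i^{\pm1}\otimes K_i^{\pm1}$ and counit $e,f\mapsto 0$, $K_i^{\pm1}\mapsto 1$. Let $E$ be the $\mathbf{U}$-module with $\mathbb{Q}(v)$-basis $e_1,e_2$ on which $$e\mapsto\begin{pmatrix}0&1\\0&0\end{pmatrix},\quad f\mapsto\begin{pmatrix}0&0\\1&0\end{pmatrix},\quad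 K_1\mapsto\begin{pmatrix}v&0\\0&1\end{pmatrix},\quad K_2\mapsto\begin{pmatrix}1&0\\0&v\end{pmatrix},$$ and let $\rho_d:\mathbf{U}\to\operatorname{End}_{\mathbb{Q}(v)}(E^{\otimes d})$ be the resulting representation on its $d$-th tensor power (the trivial representation, given by the counit, for $d=0$). The quantum Schur algebra $S_v(2,d)$ is the image of $\rho_d$. **Theorem.** Over $\mathbb{Q}(v)$, the quantum Schur algebra $S_v(2,d)$ is isomorphic to the algebra generated by $e$, $f$, $K_2^{\pm1}$ subject to the relations $$K_2K_2^{-1}=K_2^{-1}K_2=1,$$ $$K_2eK_2^{-1}=v^{-1}e,\qquad K_2fK_2^{-1}=vf,$$ $$ef-fe=\frac{v^dK_2^{-2}-v^{-d}K_2^{2}}{v-v^{-1}},$$ $$(K_2-1)(K_2-v)(K_2-v^2)\cdots(K_2-v^d)=0.$$ The isomorphism can be chosen so that the generators $e,f,K_2^{\pm1}$ correspond to $\rho_d(e),\rho_d(f),\rho_d(K_2^{\pm1})$, and $v^dK_2^{-1}$ corresponds to $\rho_d(K_1)$. -/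

import Mathlib

open scoped TensorProduct

noncomputable section

namespace QSchur

/-- The base field `ℚ(v)`. -/
abbrev Qv : Type := RatFunc ℚ

/-- The indeterminate `v` of `ℚ(v)`. -/
abbrev v : Qv := RatFunc.X

/-! ### The quantized enveloping algebra of `𝔤𝔩₂` -/

/-- Names of the generators `e`, `f`, `K₁`, `K₁⁻¹`, `K₂`, `K₂⁻¹` of `U_v(𝔤𝔩₂)`. -/
inductive GLGen : Type
  | e | f | K₁ | K₁inv | K₂ | K₂inv

/-- The generators in the free algebra. -/
abbrev glι (x : GLGen) : FreeAlgebra Qv GLGen := FreeAlgebra.ι Qv x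

open GLGen in
/-- The defining relations of `U_v(𝔤𝔩₂)`. -/
inductive GLRel : FreeAlgebra Qv GLGen → FreeAlgebra Qv GLGen → Prop
  | K₁_K₂ : GLRel (glι K₁ * glι K₂) (glι K₂ * glι K₁)
  | K₁_K₁inv : GLRel (glι K₁ * glι K₁inv) 1
  | K₁inv_K₁ : GLRel (glι K₁inv * glι K₁) 1
  | K₂_K₂inv : GLRel (glι K₂ * glι K₂inv) 1
  | K₂inv_K₂ : GLRel (glι K₂inv * glι K₂) 1
  | K₁_e : GLRel (glι K₁ * glι e * glι K₁inv) (v • glι e)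
  | K₁_f : GLRel (glι K₁ * glι f * glι K₁inv) (v⁻¹ • glι f)
  | K₂_e : GLRel (glι K₂ * glι e * glι K₂inv) (v⁻¹ • glι e)
  | K₂_f : GLRel (glι K₂ * glι f * glι K₂inv) (v • glι f)
  | e_f : GLRel (glι e * glι f - glι f * glι e)
      ((v - v⁻¹)⁻¹ • (glι K₁ * glι K₂inv - glι K₁inv * glι K₂))

/-- The quantized enveloping algebra `U_v(𝔤𝔩₂)` over `ℚ(v)`. -/
abbrev U : Type := RingQuot GLRel

/-- The image of a generator in `U_v(𝔤𝔩₂)`. -/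
def U.gen (x : GLGen) : U := RingQuot.mkAlgHom Qv GLRel (glι x)

/-- The six elements `e, f, K₁, K₁⁻¹, K₂, K₂⁻¹` of a `ℚ(v)`-algebra satisfy the defining
relations of `U_v(𝔤𝔩₂)`. -/
structure IsGL {A : Type*} [Ring A] [Algebra Qv A] (x : GLGen → A) : Prop where
  K₁_K₂ : x .K₁ * x .K₂ = x .K₂ * x .K₁
  K₁_K₁inv : x .K₁ * x .K₁inv = 1
  K₁inv_K₁ : x .K₁inv * x .K₁ = 1
  K₂_K₂inv : x .K₂ * x .K₂inv = 1
  K₂inv_K₂ : x .K₂inv * x .K₂ = 1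
  K₁_e : x .K₁ * x .e * x .K₁inv = v • x .e
  K₁_f : x .K₁ * x .f * x .K₁inv = v⁻¹ • x .f
  K₂_e : x .K₂ * x .e * x .K₂inv = v⁻¹ • x .e
  K₂_f : x .K₂ * x .f * x .K₂inv = v • x .f
  e_f : x .e * x .f - x .f * x .e =
    (v - v⁻¹)⁻¹ • (x .K₁ * x .K₂inv - x .K₁inv * x .K₂)

theorem U.isGL : IsGL U.gen := by
  constructor <;> simp only [U.gen, ← map_mul, ← map_sub, ← map_smul,
    ← map_one (RingQuot.mkAlgHom Qv GLRel)] <;>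
    exact RingQuot.mkAlgHom_rel Qv (by constructor)

/-- The universal property of `U_v(𝔤𝔩₂)`. -/
def U.lift {A : Type*} [Ring A] [Algebra Qv A] (x : GLGen → A) (hx : IsGL x) : U →ₐ[Qv] A :=
  RingQuot.liftAlgHom Qv ⟨FreeAlgebra.lift Qv x, by
    intro a b h
    cases h <;> simp [hx.K₁_K₂, hx.K₁_K₁inv, hx.K₁inv_K₁, hx.K₂_K₂inv, hx.K₂inv_K₂, hx.K₁_e,
      hx.K₁_f, hx.K₂_e, hx.K₂_f, hx.e_f]⟩

@[simp]
theorem U.lift_gen {A : Type*} [Ring A] [Algebra Qv A] (x : GLGen → A) (hx : IsGL x)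
    (g : GLGen) : U.lift x hx (U.gen g) = x g := by
  simp [U.lift, U.gen]

theorem U.hom_ext {A : Type*} [Semiring A] [Algebra Qv A] {φ ψ : U →ₐ[Qv] A}
    (h : ∀ g, φ (U.gen g) = ψ (U.gen g)) : φ = ψ := by
  apply RingQuot.ringQuot_ext'
  apply FreeAlgebra.hom_ext
  funext g
  exact h g

/-! ### The bialgebra structure of `U_v(𝔤𝔩₂)` -/

/-- The comultiplication on generators: `Δ(e) = e ⊗ 1 + K ⊗ e`, `Δ(f) = f ⊗ K⁻¹ + 1 ⊗ f` with
`K = K₁ K₂⁻¹`, and `K₁^{±1}`, `K₂^{±1}` are group-like. -/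
def comulGen {A : Type*} [Ring A] [Algebra Qv A] (x : GLGen → A) : GLGen → A ⊗[Qv] A
  | .e => x .e ⊗ₜ 1 + (x .K₁ * x .K₂inv) ⊗ₜ x .e
  | .f => x .f ⊗ₜ (x .K₁inv * x .K₂) + 1 ⊗ₜ x .f
  | .K₁ => x .K₁ ⊗ₜ x .K₁
  | .K₁inv => x .K₁inv ⊗ₜ x .K₁inv
  | .K₂ => x .K₂ ⊗ₜ x .K₂
  | .K₂inv => x .K₂inv ⊗ₜ x .K₂inv

/-- The counit on generators. -/
def counitGen : GLGen → Qv
  | .e => 0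
  | .f => 0
  | _ => 1

theorem v_ne_zero : v ≠ 0 := RatFunc.X_ne_zero

theorem isGL_counitGen : IsGL counitGen := by
  constructor <;> simp [counitGen]

section
variable {A : Type*} [Ring A] [Algebra Qv A] {x : GLGen → A}

theorem IsGL.comul (hx : IsGL x) : IsGL (comulGen x) := by
  have a1 := hx.K₁_K₁inv
  have a2 := hx.K₁inv_K₁
  have b1 := hx.K₂_K₂inv
  have b2 := hx.K₂inv_K₂
  have c := hx.K₁_K₂
  let u₁ : Aˣ := ⟨x .K₁, x .K₁inv, a1, a2⟩
  let u₂ : Aˣ := ⟨x .K₂, x .K₂inv, b1, b2⟩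
  have hc : Commute u₁ u₂ := Units.ext c
  have c1 : x .K₁ * x .K₂inv = x .K₂inv * x .K₁ :=
    congrArg Units.val (hc.inv_right : Commute u₁ u₂⁻¹).eq
  have c2 : x .K₁inv * x .K₂ = x .K₂ * x .K₁inv :=
    congrArg Units.val (hc.inv_left : Commute u₁⁻¹ u₂).eq
  have c3 : x .K₁inv * x .K₂inv = x .K₂inv * x .K₁inv :=
    congrArg Units.val (hc.inv_inv : Commute u₁⁻¹ u₂⁻¹).eq
  have k1 : x .K₁ * (x .K₁ * x .K₂inv) * x .K₁inv = x .K₁ * x .K₂inv := by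
    rw [mul_assoc, mul_assoc, ← c3, ← mul_assoc (x .K₁) (x .K₁inv), a1, one_mul]
  have k2 : x .K₂ * (x .K₁ * x .K₂inv) * x .K₂inv = x .K₁ * x .K₂inv := by
    rw [← mul_assoc, ← c, mul_assoc (x .K₁), b1, mul_one]
  have k3 : x .K₁ * (x .K₁inv * x .K₂) * x .K₁inv = x .K₁inv * x .K₂ := by
    rw [← mul_assoc, a1, one_mul, c2]
  have k4 : x .K₂ * (x .K₁inv * x .K₂) * x .K₂inv = x .K₁inv * x .K₂ := by
    rw [mul_assoc, mul_assoc, b1, mul_one, c2]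
  have e1 : x .K₁ * x .e = v • (x .e * x .K₁) := by
    rw [← smul_mul_assoc, ← hx.K₁_e, mul_assoc _ _ (x .K₁), a2, mul_one]
  have f1 : x .K₁ * x .f = v⁻¹ • (x .f * x .K₁) := by
    rw [← smul_mul_assoc, ← hx.K₁_f, mul_assoc _ _ (x .K₁), a2, mul_one]
  have e2 : x .K₂ * x .e = v⁻¹ • (x .e * x .K₂) := by
    rw [← smul_mul_assoc, ← hx.K₂_e, mul_assoc _ _ (x .K₂), b2, mul_one]
  have f2 : x .K₂inv * x .f = v⁻¹ • (x .f * x .K₂inv) := by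
    have h : x .f * x .K₂inv = v • (x .K₂inv * x .f) := by
      rw [← mul_smul_comm, ← hx.K₂_f, ← mul_assoc, ← mul_assoc, b2, one_mul]
    rw [h, smul_smul, inv_mul_cancel₀ v_ne_zero, one_smul]
  have e3 : x .K₁inv * x .e = v⁻¹ • (x .e * x .K₁inv) := by
    have h : x .e * x .K₁inv = v • (x .K₁inv * x .e) := by
      rw [← mul_smul_comm, ← hx.K₁_e, ← mul_assoc, ← mul_assoc, a2, one_mul]
    rw [h, smul_smul, inv_mul_cancel₀ v_ne_zero, one_smul]
  have g1 : (x .K₁ * x .K₂inv) * x .f = (v⁻¹ * v⁻¹) • (x .f * (x .K₁ * x .K₂inv)) := by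
    rw [mul_assoc, f2, mul_smul_comm, ← mul_assoc, f1, smul_mul_assoc, smul_smul, mul_assoc]
  have g2 : (x .K₁inv * x .K₂) * x .e = (v⁻¹ * v⁻¹) • (x .e * (x .K₁inv * x .K₂)) := by
    rw [mul_assoc, e2, mul_smul_comm, ← mul_assoc, e3, smul_mul_assoc, smul_smul, mul_assoc]
  have ef := hx.e_f
  constructor
  · simp [comulGen, c]
  · simp [comulGen, a1, Algebra.TensorProduct.one_def]
  · simp [comulGen, a2, Algebra.TensorProduct.one_def]
  · simp [comulGen, b1, Algebra.TensorProduct.one_def]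
  · simp [comulGen, b2, Algebra.TensorProduct.one_def]
  · simp only [comulGen, mul_add, add_mul, Algebra.TensorProduct.tmul_mul_tmul, mul_one,
      k1, a1, hx.K₁_e, smul_add, TensorProduct.smul_tmul', TensorProduct.tmul_smul]
  · simp only [comulGen, mul_add, add_mul, Algebra.TensorProduct.tmul_mul_tmul, mul_one,
      k3, a1, hx.K₁_f, smul_add, TensorProduct.smul_tmul', TensorProduct.tmul_smul]
  · simp only [comulGen, mul_add, add_mul, Algebra.TensorProduct.tmul_mul_tmul, mul_one,
      k2, b1, hx.K₂_e, smul_add, TensorProduct.smul_tmul', TensorProduct.tmul_smul]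
  · simp only [comulGen, mul_add, add_mul, Algebra.TensorProduct.tmul_mul_tmul, mul_one,
      k4, b1, hx.K₂_f, smul_add, TensorProduct.smul_tmul', TensorProduct.tmul_smul]
  · have h1 : (x .e * x .f) = x .f * x .e +
        (v - v⁻¹)⁻¹ • (x .K₁ * x .K₂inv - x .K₁inv * x .K₂) := by rw [← ef]; abel
    simp only [comulGen, mul_add, add_mul, Algebra.TensorProduct.tmul_mul_tmul, mul_one, one_mul,
      g1, g2, h1, TensorProduct.add_tmul, TensorProduct.tmul_add, TensorProduct.tmul_smul,
      ← TensorProduct.smul_tmul', TensorProduct.sub_tmul, TensorProduct.tmul_sub, smul_sub]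
    abel

end

/-- The comultiplication `Δ : U → U ⊗ U`. -/
def U.comul : U →ₐ[Qv] U ⊗[Qv] U := U.lift (comulGen U.gen) U.isGL.comul

/-- The counit `ε : U → ℚ(v)`. -/
def U.counit : U →ₐ[Qv] Qv := U.lift counitGen isGL_counitGen

instance : Bialgebra Qv U := Bialgebra.ofAlgHom U.comul U.counit
  (by
    apply U.hom_ext
    intro g
    cases g <;>
      simp [U.comul, comulGen, TensorProduct.add_tmul, TensorProduct.tmul_add,
        Algebra.TensorProduct.one_def, add_assoc])
  (by
    apply U.hom_ext
    intro g
    cases g <;> simp [U.comul, U.counit, comulGen, counitGen])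
  (by
    apply U.hom_ext
    intro g
    cases g <;> simp [U.comul, U.counit, comulGen, counitGen])

/-! ### The representation on tensor space and the quantum Schur algebra -/

/-- The natural two-dimensional module `E`, with its standard basis. -/
abbrev E : Type := Fin 2 → Qv

/-- The matrices by which the generators act on `E`. -/
def natMat : GLGen → Matrix (Fin 2) (Fin 2) Qv
  | .e => !![0, 1; 0, 0]
  | .f => !![0, 0; 1, 0]
  | .K₁ => !![v, 0; 0, 1]
  | .K₁inv => !![v⁻¹, 0; 0, 1]
  | .K₂ => !![1, 0; 0, v]
  | .K₂inv => !![1, 0; 0, v⁻¹]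

theorem v_sub_ne_zero : v - v⁻¹ ≠ 0 := by
  intro h
  have hv := v_ne_zero
  have h1 : v * v = 1 := by
    have := sub_eq_zero.mp h
    calc v * v = v * v⁻¹ := by rw [← this]
      _ = 1 := mul_inv_cancel₀ hv
  have h2 : (Polynomial.X * Polynomial.X : Polynomial ℚ) = 1 := by
    apply RatFunc.algebraMap_injective ℚ
    simpa using h1
  have := congrArg (Polynomial.eval 0) h2
  simp at this

theorem isGL_natMat : IsGL natMat := by
  have hv := v_ne_zero
  have hs := v_sub_ne_zero
  constructor <;> simp only [natMat] <;> ext i j <;> fin_cases i <;> fin_cases j <;>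
    simp [Matrix.mul_apply, Fin.sum_univ_two, hv]
  · exact (inv_mul_cancel₀ hs).symm
  · rw [← neg_sub v v⁻¹, mul_neg, inv_mul_cancel₀ hs]

/-- The natural representation `ρ : U → End(E)`. -/
def rho : U →ₐ[Qv] Module.End Qv E :=
  (Matrix.toLinAlgEquiv' : Matrix (Fin 2) (Fin 2) Qv ≃ₐ[Qv] Module.End Qv E).toAlgHom.comp
    (U.lift natMat isGL_natMat)

/-- The tensor product of two representations of `U`, formed with the comultiplication. -/
def tensorRep {M N : Type*} [AddCommGroup M] [Module Qv M] [AddCommGroup N] [Module Qv N]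
    (σ : U →ₐ[Qv] Module.End Qv M) (τ : U →ₐ[Qv] Module.End Qv N) :
    U →ₐ[Qv] Module.End Qv (M ⊗[Qv] N) :=
  (Module.endTensorEndAlgHom.comp (Algebra.TensorProduct.map σ τ)).comp
    (Bialgebra.comulAlgHom Qv U)

/-- The canonical isomorphism `E^{⊗d} ⊗ E ≃ E^{⊗(d+1)}`. -/
def tensorPowSucc (d : ℕ) : (⨂[Qv]^d E) ⊗[Qv] E ≃ₗ[Qv] ⨂[Qv]^(d + 1) E :=
  (TensorProduct.congr (LinearEquiv.refl Qv _)
    (PiTensorProduct.subsingletonEquiv (R := Qv) (s := fun _ : Fin 1 => E) 0).symm).trans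
    TensorPower.mulEquiv

/-- The representation `ρ_d : U → End(E^{⊗d})` on the `d`-th tensor power of `E`: the trivial
representation (given by the counit) for `d = 0`, and the tensor product of `ρ_d` and `ρ` for
`d + 1`. -/
def rhoPow : (d : ℕ) → U →ₐ[Qv] Module.End Qv (⨂[Qv]^d E)
  | 0 => (Algebra.ofId Qv _).comp (Bialgebra.counitAlgHom Qv U)
  | d + 1 => ((tensorPowSucc d).conjAlgEquiv Qv).toAlgHom.comp (tensorRep (rhoPow d) rho)

/-- The quantum Schur algebra `S_v(2,d)` is the image of `ρ_d`. -/
abbrev Schur (d : ℕ) : Subalgebra Qv (Module.End Qv (⨂[Qv]^d E)) := (rhoPow d).range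

/-- The surjection `U → S_v(2,d)` induced by `ρ_d`. -/
abbrev toSchur (d : ℕ) : U →ₐ[Qv] Schur d := (rhoPow d).rangeRestrict

/-! ### The algebra presented by generators and relations -/

/-- Names of the generators `e`, `f`, `K₂`, `K₂⁻¹`. -/
inductive PGen : Type
  | e | f | K₂ | K₂inv

/-- The generators in the free algebra. -/
abbrev pι (x : PGen) : FreeAlgebra Qv PGen := FreeAlgebra.ι Qv x

open PGen in
/-- The defining relations of the presented algebra. The product in the last relation is
`(K₂ - 1)(K₂ - v) ⋯ (K₂ - v^d)`. -/
inductive PRel (d : ℕ) : FreeAlgebra Qv PGen → FreeAlgebra Qv PGen → Prop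
  | K₂_K₂inv : PRel d (pι K₂ * pι K₂inv) 1
  | K₂inv_K₂ : PRel d (pι K₂inv * pι K₂) 1
  | K₂_e : PRel d (pι K₂ * pι e * pι K₂inv) (v⁻¹ • pι e)
  | K₂_f : PRel d (pι K₂ * pι f * pι K₂inv) (v • pι f)
  | e_f : PRel d (pι e * pι f - pι f * pι e)
      ((v - v⁻¹)⁻¹ • (v ^ d • pι K₂inv ^ 2 - (v ^ d)⁻¹ • pι K₂ ^ 2))
  | prod_K₂ : PRel d
      ((List.range (d + 1)).map fun i => pι K₂ - algebraMap Qv _ (v ^ i)).prod 0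

/-- The `ℚ(v)`-algebra generated by `e`, `f`, `K₂^{±1}` subject to the relations `PRel d`. -/
abbrev Presented (d : ℕ) : Type := RingQuot (PRel d)

/-- The image of a generator in the presented algebra. -/
def Presented.gen (d : ℕ) (x : PGen) : Presented d := RingQuot.mkAlgHom Qv (PRel d) (pι x)

end QSchur

end

noncomputable section

namespace QSchur

open Polynomial

/-! ### Powers of the indeterminate -/

/-! Sending generators to generators defines a map onto the Schur algebra, because `K₁K₂` acts on
tensor space as the scalar `v ^ d` and the weights of `K₂` are `1, v, …, v ^ d`. The content is
injectivity: an element `a` of the presented algebra that kills tensor space is zero.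

The Casimir element commutes with the generators. On weight `j` it differs from `f e` by the scalar
`casimirValue d j`, and from `e f` by `casimirValue d (j + 1)`. The product relation bounds the
weights, so enough steps down by `e` or up by `f` give zero; hence on each weight space the Casimir
satisfies a polynomial with simple roots. The unit of the presented algebra is therefore a sum of
vectors `u` of weight `i` with Casimir value of index `r`, where `r ≤ i ≤ d - r`
(`mem_of_prod_smul_eq_zero`, `eq_zero_of_forall_smul_eq_zero`).

It remains to see that `a` kills each `u` (`smul_eq_zero_of_isIsotypic`). Tensor space has a highest
weight vector of weight `r` (`exists_highest_weight_vector`), hence a nonzero `z` of the same type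
as `u`. The pair `(u, z)` generates a module spanned by one vector for each weight from `r` to `d -
r`, and the second components of these are linearly independent. Since `a` kills `z`, all
coefficients of `a (u, z)` vanish, and so `a u = 0`. No basis or dimension count is needed. -/

theorem v_pow_eq_one {n : ℕ} (h : v ^ n = 1) : n = 0 := by
  have h2 : (Polynomial.X ^ n : ℚ[X]) = 1 := by
    apply RatFunc.algebraMap_injective ℚ
    simpa using h
  simpa using congrArg Polynomial.natDegree h2

theorem v_zpow_eq_one {n : ℤ} (h : v ^ n = 1) : n = 0 := by
  rcases Int.eq_nat_or_neg n with ⟨m, rfl | rfl⟩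
  · simpa using v_pow_eq_one (by simpa using h)
  · simpa using v_pow_eq_one (n := m) (by simpa using h)

theorem v_zpow_injective : Function.Injective (fun n : ℤ => v ^ n) := by
  intro a b h
  have : v ^ (a - b) = 1 := by
    rw [zpow_sub₀ v_ne_zero, show v ^ a = v ^ b from h, div_self (zpow_ne_zero _ v_ne_zero)]
  have := v_zpow_eq_one this
  omega

/-- The value of the Casimir element of the presented algebra on a vector of weight `s` killed
by `e`. -/
def casimirValue (d : ℕ) (s : ℤ) : Qv :=
  (v - v⁻¹)⁻¹ ^ 2 * (v ^ ((d : ℤ) + 1 - 2 * s) + (v ^ ((d : ℤ) + 1 - 2 * s))⁻¹)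

/-- The reflection `s ↦ d + 1 - s` inverts the power of `v`. Thanks to it, the arguments with `e`
and with `f` yield the same Casimir polynomials. -/
theorem casimirValue_symm (d : ℕ) (s : ℤ) : casimirValue d (d + 1 - s) = casimirValue d s := by
  have : (d : ℤ) + 1 - 2 * (d + 1 - s) = -((d : ℤ) + 1 - 2 * s) := by ring
  rw [casimirValue, casimirValue, this, zpow_neg, inv_inv, add_comm]

/-- A sum `a + a⁻¹` determines `a` up to inversion, and `v` is not a root of unity, so the
reflection is the only coincidence of Casimir values. All semisimplicity below comes from this. -/
theorem casimirValue_sub_ne_zero {d : ℕ} {r s : ℤ} (h₁ : r ≠ s) (h₂ : r + s ≠ d + 1) :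
    casimirValue d r - casimirValue d s ≠ 0 := by
  intro h
  have hv : (v - v⁻¹)⁻¹ ^ 2 ≠ 0 := pow_ne_zero _ (inv_ne_zero v_sub_ne_zero)
  rw [casimirValue, casimirValue, ← mul_sub] at h
  have h := (mul_eq_zero.mp h).resolve_left hv
  have ha : v ^ ((d : ℤ) + 1 - 2 * r) ≠ 0 := zpow_ne_zero _ v_ne_zero
  have hb : v ^ ((d : ℤ) + 1 - 2 * s) ≠ 0 := zpow_ne_zero _ v_ne_zero
  have h3 : (v ^ ((d : ℤ) + 1 - 2 * r) - v ^ ((d : ℤ) + 1 - 2 * s)) *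
      (v ^ ((d : ℤ) + 1 - 2 * r) * v ^ ((d : ℤ) + 1 - 2 * s) - 1) = 0 := by
    generalize v ^ ((d : ℤ) + 1 - 2 * r) = a at *
    generalize v ^ ((d : ℤ) + 1 - 2 * s) = b at *
    field_simp at h
    linear_combination h
  rcases mul_eq_zero.mp h3 with h4 | h4
  · have := v_zpow_injective (sub_eq_zero.mp h4)
    omega
  · rw [← zpow_add₀ v_ne_zero] at h4
    have := v_zpow_eq_one (sub_eq_zero.mp h4)
    omega

/-! ### Decomposition into eigenvectors -/

section
variable {A M : Type*} [Ring A] [Algebra Qv A] [AddCommGroup M] [Module Qv M] [Module A M]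
  [IsScalarTower Qv A M]

theorem aeval_smul_of_smul_eq {T : A} {y : M} {a : Qv} (h : T • y = a • y) (p : Qv[X]) :
    aeval T p • y = p.eval a • y := by
  induction p using Polynomial.induction_on' with
  | add p q hp hq => rw [map_add, add_smul, hp, hq, eval_add, add_smul]
  | monomial n c =>
    have hn : T ^ n • y = a ^ n • y := by
      induction n with
      | zero => simp
      | succ n ih =>
        rw [pow_succ, mul_smul, h, smul_comm, ih, smul_smul, pow_succ']
    rw [aeval_monomial, eval_monomial, ← Algebra.smul_def, smul_assoc, hn, smul_smul]

theorem sq_smul_of_smul {T : A} {y : M} {a : Qv} (h : T • y = a • y) :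
    T ^ 2 • y = a ^ 2 • y := by
  rw [pow_two, mul_smul, h, smul_comm, h, smul_smul, pow_two]

theorem commute_aeval {S T : A} (h : Commute S T) (p : Qv[X]) : Commute S (aeval T p) := by
  induction p using Polynomial.induction_on' with
  | add p q hp hq => rw [map_add]; exact hp.add_right hq
  | monomial n c =>
    rw [aeval_monomial]
    exact (Algebra.commute_algebraMap_right c S).mul_right (h.pow_right n)

/-- Bézout for coprime linear factors splits `y` into eigenvectors of `T` that are polynomials in
`T` applied to `y`. The stable subspace `W` allows a second splitting inside an eigenspace of
another operator. -/
theorem mem_of_prod_smul_eq_zero {ι : Type*} (T : A) (μ : ι → Qv) (W N : Submodule Qv M)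
    (hW : ∀ (p : Qv[X]), ∀ y ∈ W, aeval T p • y ∈ W) (s : Finset ι) (hμ : Set.InjOn μ s)
    (hN : ∀ i ∈ s, ∀ y ∈ W, T • y = μ i • y → y ∈ N) {y : M} (hy : y ∈ W)
    (h : aeval T (∏ i ∈ s, (X - C (μ i))) • y = 0) : y ∈ N := by
  classical
  induction s using Finset.induction_on generalizing y with
  | empty =>
    simp only [Finset.prod_empty, map_one, one_smul] at h
    exact h ▸ N.zero_mem
  | insert a s ha ih =>
    rw [Finset.prod_insert ha] at h
    have hc : IsCoprime (X - C (μ a)) (∏ i ∈ s, (X - C (μ i))) := by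
      refine IsCoprime.prod_right fun i hi => isCoprime_X_sub_C_of_isUnit_sub ?_
      refine (sub_ne_zero.mpr fun hai => ha ?_).isUnit
      rwa [hμ (by simp) (by simp [hi]) hai]
    obtain ⟨α, β, hαβ⟩ := hc
    have hdec : y = aeval T (α * (X - C (μ a))) • y +
        aeval T (β * ∏ i ∈ s, (X - C (μ i))) • y := by
      rw [← add_smul, ← map_add, hαβ, map_one, one_smul]
    rw [hdec]
    refine N.add_mem (ih (hμ.mono (by simp)) (fun i hi => hN i (by simp [hi]))
      (hW _ _ hy) ?_) (hN a (by simp) _ (hW _ _ hy) ?_)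
    · rw [← mul_smul, ← map_mul, show (∏ i ∈ s, (X - C (μ i))) * (α * (X - C (μ a))) =
        α * ((X - C (μ a)) * ∏ i ∈ s, (X - C (μ i))) by ring, map_mul, mul_smul, h, smul_zero]
    · have : aeval T (X - C (μ a)) • aeval T (β * ∏ i ∈ s, (X - C (μ i))) • y = 0 := by
        rw [← mul_smul, ← map_mul, show (X - C (μ a)) * (β * ∏ i ∈ s, (X - C (μ i))) =
          β * ((X - C (μ a)) * ∏ i ∈ s, (X - C (μ i))) by ring, map_mul, mul_smul, h, smul_zero]
      rw [map_sub, aeval_X, aeval_C, sub_smul, sub_eq_zero, algebraMap_smul] at this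
      exact this

end

/-! ### The relations of the presented algebra -/

theorem sq_mul_of_mul {A : Type*} [Ring A] [Algebra Qv A] {a b : A} {c : Qv}
    (h : a * b = c • (b * a)) : a ^ 2 * b = (c ^ 2) • (b * a ^ 2) := by
  rw [pow_two, mul_assoc, h, mul_smul_comm, ← mul_assoc, h, smul_mul_assoc, smul_smul,
    ← pow_two, mul_assoc, ← pow_two]

/-- The four elements `e, f, K₂, K₂⁻¹` of a `ℚ(v)`-algebra satisfy the defining relations of the
presented algebra. -/
structure IsPresented (d : ℕ) {A : Type*} [Ring A] [Algebra Qv A] (x : PGen → A) : Prop where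
  K₂_K₂inv : x .K₂ * x .K₂inv = 1
  K₂inv_K₂ : x .K₂inv * x .K₂ = 1
  K₂_e : x .K₂ * x .e * x .K₂inv = v⁻¹ • x .e
  K₂_f : x .K₂ * x .f * x .K₂inv = v • x .f
  e_f : x .e * x .f - x .f * x .e =
    (v - v⁻¹)⁻¹ • (v ^ d • x .K₂inv ^ 2 - (v ^ d)⁻¹ • x .K₂ ^ 2)
  prod_K₂ : ((List.range (d + 1)).map fun i => x .K₂ - algebraMap Qv A (v ^ i)).prod = 0

/-- The Casimir element. -/
def casimir (d : ℕ) {A : Type*} [Ring A] [Algebra Qv A] (x : PGen → A) : A :=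
  x .f * x .e +
    (v - v⁻¹)⁻¹ ^ 2 • (v ^ (d + 1) • x .K₂inv ^ 2 + (v ^ (d + 1))⁻¹ • x .K₂ ^ 2)

namespace IsPresented

variable {d : ℕ} {A : Type*} [Ring A] [Algebra Qv A] {x : PGen → A} (hx : IsPresented d x)
include hx

theorem K₂_mul_e : x .K₂ * x .e = v⁻¹ • (x .e * x .K₂) := by
  rw [← smul_mul_assoc, ← hx.K₂_e, mul_assoc _ _ (x .K₂), hx.K₂inv_K₂, mul_one]

theorem K₂_mul_f : x .K₂ * x .f = v • (x .f * x .K₂) := by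
  rw [← smul_mul_assoc, ← hx.K₂_f, mul_assoc _ _ (x .K₂), hx.K₂inv_K₂, mul_one]

theorem K₂inv_mul_e : x .K₂inv * x .e = v • (x .e * x .K₂inv) := by
  have h : x .e * x .K₂inv = v⁻¹ • (x .K₂inv * x .e) := by
    rw [← mul_smul_comm, ← hx.K₂_e, ← mul_assoc, ← mul_assoc, hx.K₂inv_K₂, one_mul]
  rw [h, smul_smul, mul_inv_cancel₀ v_ne_zero, one_smul]

theorem K₂inv_mul_f : x .K₂inv * x .f = v⁻¹ • (x .f * x .K₂inv) := by
  have h : x .f * x .K₂inv = v • (x .K₂inv * x .f) := by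
    rw [← mul_smul_comm, ← hx.K₂_f, ← mul_assoc, ← mul_assoc, hx.K₂inv_K₂, one_mul]
  rw [h, smul_smul, inv_mul_cancel₀ v_ne_zero, one_smul]

/-- The commutator relation trades `f e` for `e f`. Having both forms makes centrality and the
action of `e f` immediate. -/
theorem casimir_eq : casimir d x = x .e * x .f +
    (v - v⁻¹)⁻¹ ^ 2 • ((v ^ d * v⁻¹) • x .K₂inv ^ 2 + ((v ^ d)⁻¹ * v) • x .K₂ ^ 2) := by
  have h := hx.e_f
  have hv := v_ne_zero
  have hs := v_sub_ne_zero
  rw [sub_eq_iff_eq_add'] at h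
  rw [h, casimir, add_assoc]
  congr 1
  simp only [smul_add, smul_sub, smul_smul]
  rw [add_comm (((v - v⁻¹)⁻¹ ^ 2 * (v ^ d * v⁻¹)) • x .K₂inv ^ 2), ← add_assoc,
    sub_add, ← sub_smul, sub_add_eq_add_sub, ← add_smul, sub_eq_add_neg (_ • _), ← neg_smul]
  congr 2
  · rw [pow_succ v d]
    field_simp
    ring
  · field_simp
    ring

theorem commute_casimir_e : Commute (x .e) (casimir d x) := by
  have hv := v_ne_zero
  rw [Commute, SemiconjBy]
  -- With `f e` in one copy and `e f` in the other, both sides contain `e f e`; only the powers of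
  -- `v` from moving `K₂^{±2}` past `e` remain to be compared.
  conv_rhs => rw [hx.casimir_eq]
  simp only [casimir, mul_add, add_mul, mul_smul_comm, smul_mul_assoc,
    sq_mul_of_mul hx.K₂inv_mul_e, sq_mul_of_mul hx.K₂_mul_e, smul_smul, mul_assoc]
  congr 5
  · rw [pow_succ]
    field_simp
  · rw [pow_succ]
    field_simp

theorem commute_casimir_f : Commute (x .f) (casimir d x) := by
  have hv := v_ne_zero
  rw [Commute, SemiconjBy]
  conv_lhs => rw [hx.casimir_eq]
  simp only [casimir, mul_add, add_mul, mul_smul_comm, smul_mul_assoc,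
    sq_mul_of_mul hx.K₂inv_mul_f, sq_mul_of_mul hx.K₂_mul_f, smul_smul, mul_assoc]
  congr 4
  · rw [pow_succ]
    field_simp
  · rw [pow_succ]
    field_simp

theorem commute_casimir_K₂ : Commute (x .K₂) (casimir d x) := by
  have h1 : Commute (x .K₂) (x .K₂inv) := hx.K₂_K₂inv.trans hx.K₂inv_K₂.symm
  have h2 : Commute (x .K₂) (x .f * x .e) := by
    rw [Commute, SemiconjBy, ← mul_assoc, hx.K₂_mul_f, smul_mul_assoc, mul_assoc, hx.K₂_mul_e,
      mul_smul_comm, smul_smul, mul_inv_cancel₀ v_ne_zero, one_smul, mul_assoc]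
  exact h2.add_right ((((h1.pow_right 2).smul_right _).add_right
    (((Commute.refl _).pow_right 2).smul_right _)).smul_right _)

/-! ### Weight vectors in a module over the presented relations -/

section
variable {M : Type*} [AddCommGroup M] [Module Qv M] [Module A M] [IsScalarTower Qv A M]

/-- On weight `j` the product relation acts as `∏ (v ^ j - v ^ i)` over `0 ≤ i ≤ d`, a nonzero
scalar. -/
theorem eq_zero_of_weight {j : ℤ} (hj : j < 0 ∨ d < j) {y : M} (hy : x .K₂ • y = v ^ j • y) :
    y = 0 := by
  have h : ∀ l : List ℕ, (l.map fun i => x .K₂ - algebraMap Qv A (v ^ i)).prod • y =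
      (l.map fun i => v ^ j - v ^ i).prod • y := by
    intro l
    induction l with
    | nil => simp
    | cons a l ih =>
      rw [List.map_cons, List.prod_cons, mul_smul, ih, smul_comm, sub_smul, hy, algebraMap_smul,
        ← sub_smul, smul_smul, List.map_cons, List.prod_cons, mul_comm]
  have h := h (List.range (d + 1))
  rw [hx.prod_K₂, zero_smul] at h
  refine (smul_eq_zero.mp h.symm).resolve_left ?_
  rw [List.prod_eq_zero_iff]
  simp only [List.mem_map, List.mem_range, not_exists, not_and]
  intro i hi h0
  have := v_zpow_injective ((sub_eq_zero.mp h0).trans (zpow_natCast v i).symm)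
  omega

theorem K₂inv_smul {j : ℤ} {y : M} (hy : x .K₂ • y = v ^ j • y) :
    x .K₂inv • y = (v ^ j)⁻¹ • y := by
  have hv : v ^ j ≠ 0 := zpow_ne_zero _ v_ne_zero
  rw [eq_inv_smul_iff₀ hv, smul_comm, ← hy, ← mul_smul, hx.K₂inv_K₂, one_smul]

theorem weight_e {j : ℤ} {y : M} (hy : x .K₂ • y = v ^ j • y) :
    x .K₂ • x .e • y = v ^ (j - 1) • x .e • y := by
  rw [← mul_smul, hx.K₂_mul_e, smul_assoc, mul_smul, hy, smul_comm (x .e), smul_smul,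
    zpow_sub_one₀ v_ne_zero, mul_comm]

theorem weight_f {j : ℤ} {y : M} (hy : x .K₂ • y = v ^ j • y) :
    x .K₂ • x .f • y = v ^ (j + 1) • x .f • y := by
  rw [← mul_smul, hx.K₂_mul_f, smul_assoc, mul_smul, hy, smul_comm (x .f), smul_smul,
    zpow_add_one₀ v_ne_zero, mul_comm]

theorem f_e_smul {j : ℤ} {y : M} (hy : x .K₂ • y = v ^ j • y) :
    x .f • x .e • y = casimir d x • y - casimirValue d j • y := by
  have hv := v_ne_zero
  rw [casimir, add_smul, mul_smul, add_sub_assoc, left_eq_add, sub_eq_zero]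
  rw [smul_assoc, add_smul, smul_assoc, smul_assoc, sq_smul_of_smul hy,
    sq_smul_of_smul (hx.K₂inv_smul hy), smul_smul, smul_smul, ← add_smul, smul_smul, casimirValue]
  congr 2
  rw [zpow_sub₀ hv, zpow_add₀ hv, zpow_natCast, zpow_one, pow_succ, mul_comm 2 j, zpow_mul]
  norm_cast
  generalize v ^ d = c
  generalize v ^ j = b
  field_simp

theorem e_f_smul {j : ℤ} {y : M} (hy : x .K₂ • y = v ^ j • y) :
    x .e • x .f • y = casimir d x • y - casimirValue d (j + 1) • y := by
  have hv := v_ne_zero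
  rw [hx.casimir_eq, add_smul, mul_smul, add_sub_assoc, left_eq_add, sub_eq_zero]
  rw [smul_assoc, add_smul, smul_assoc, smul_assoc, sq_smul_of_smul hy,
    sq_smul_of_smul (hx.K₂inv_smul hy), smul_smul, smul_smul, ← add_smul, smul_smul, casimirValue]
  congr 2
  rw [show (d : ℤ) + 1 - 2 * (j + 1) = d - 1 - j * 2 by ring,
    zpow_sub₀ hv, zpow_sub₀ hv, zpow_natCast, zpow_one, zpow_mul]
  norm_cast
  generalize v ^ d = c
  generalize v ^ j = b
  field_simp

/-- On weight `n` the factor with root `casimirValue d n` acts as `f e`. Peeling off factors turns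
the product into `f ^ n e ^ n`, and `e ^ n` lands in weight `-1`, which is zero. -/
theorem aeval_casimir_prod_smul_left (n : ℕ) {y : M} (hy : x .K₂ • y = v ^ ((n : ℤ) - 1) • y) :
    aeval (casimir d x) (∏ s ∈ Finset.range n, (X - C (casimirValue d s))) • y = 0 := by
  induction n generalizing y with
  | zero => rw [hx.eq_zero_of_weight (by simp) hy, smul_zero]
  | succ n ih =>
    have hn : ((n + 1 : ℕ) : ℤ) - 1 = n := by simp
    rw [hn] at hy
    rw [Finset.prod_range_succ, map_mul, mul_smul, map_sub, aeval_X, aeval_C, sub_smul,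
      algebraMap_smul, ← hx.f_e_smul hy, ← mul_smul, ← (commute_aeval hx.commute_casimir_f _).eq,
      mul_smul, ih (hx.weight_e hy), smul_zero]

theorem aeval_casimir_prod_smul_right (n : ℕ) {y : M}
    (hy : x .K₂ • y = v ^ ((d : ℤ) + 1 - n) • y) :
    aeval (casimir d x) (∏ s ∈ Finset.range n, (X - C (casimirValue d s))) • y = 0 := by
  induction n generalizing y with
  | zero => rw [hx.eq_zero_of_weight (Or.inr (by simp)) hy, smul_zero]
  | succ n ih =>
    have hn : (d : ℤ) + 1 - (n + 1 : ℕ) + 1 = d + 1 - n := by push_cast; ring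
    have h1 := hx.e_f_smul hy
    have h2 := hx.weight_f hy
    rw [hn] at h1 h2
    -- Here `e f` has the shift `casimirValue d (d + 1 - n)`; the reflection turns it into the root
    -- of index `n`.
    rw [casimirValue_symm] at h1
    rw [Finset.prod_range_succ, map_mul, mul_smul, map_sub, aeval_X, aeval_C, sub_smul,
      algebraMap_smul, ← h1, ← mul_smul, ← (commute_aeval hx.commute_casimir_e _).eq,
      mul_smul, ih h2, smul_zero]

end

end IsPresented

/-! ### Vectors of given weight and Casimir value -/

section
variable {A M : Type*} [Ring A] [Algebra Qv A] [AddCommGroup M] [Module Qv M] [Module A M]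
  [IsScalarTower Qv A M]

/-- The vector `y` has weight `j`, and the Casimir element acts on it as on a vector of weight `r`
killed by `e`. -/
structure IsIsotypic (d : ℕ) (x : PGen → A) (r j : ℤ) (y : M) : Prop where
  weight : x .K₂ • y = v ^ j • y
  casimir : casimir d x • y = casimirValue d r • y

namespace IsIsotypic

variable {d : ℕ} {x : PGen → A} {r j : ℤ} {y : M} (hx : IsPresented d x)
  (hy : IsIsotypic d x r j y)
include hx hy

theorem e_smul : IsIsotypic d x r (j - 1) (x .e • y) where
  weight := hx.weight_e hy.weight
  casimir := by
    rw [← mul_smul, ← hx.commute_casimir_e.eq, mul_smul, hy.casimir, smul_comm]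

theorem f_smul : IsIsotypic d x r (j + 1) (x .f • y) where
  weight := hx.weight_f hy.weight
  casimir := by
    rw [← mul_smul, ← hx.commute_casimir_f.eq, mul_smul, hy.casimir, smul_comm]

theorem e_pow_smul (n : ℕ) : IsIsotypic d x r (j - n) (x .e ^ n • y) := by
  induction n with
  | zero => simpa using hy
  | succ n ih =>
    rw [pow_succ', mul_smul]
    convert ih.e_smul hx using 1
    push_cast
    ring

theorem f_pow_smul (n : ℕ) : IsIsotypic d x r (j + n) (x .f ^ n • y) := by
  induction n with
  | zero => simpa using hy
  | succ n ih =>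
    rw [pow_succ', mul_smul]
    convert ih.f_smul hx using 1
    push_cast
    ring

theorem f_e_smul : x .f • x .e • y = (casimirValue d r - casimirValue d j) • y := by
  rw [hx.f_e_smul hy.weight, hy.casimir, sub_smul]

theorem e_f_smul : x .e • x .f • y = (casimirValue d r - casimirValue d (j + 1)) • y := by
  rw [hx.e_f_smul hy.weight, hy.casimir, sub_smul]

/-- Each step down can be undone: `f e` is the scalar `casimirValue d r - casimirValue d j`, nonzero
for `r < j ≤ d - r`. -/
theorem e_pow_smul_ne_zero (h0 : y ≠ 0) (hj : j ≤ d - r) (n : ℕ) (hn : r ≤ j - n) :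
    x .e ^ n • y ≠ 0 := by
  induction n with
  | zero => simpa using h0
  | succ n ih =>
    push_cast at hn
    intro h
    have h1 := (hy.e_pow_smul hx n).f_e_smul hx
    rw [← mul_smul (x .e), ← pow_succ', h, smul_zero] at h1
    exact (smul_ne_zero (casimirValue_sub_ne_zero (by omega) (by omega)) (ih (by omega))) h1.symm

theorem f_pow_smul_ne_zero (h0 : y ≠ 0) (hj : r ≤ j) (n : ℕ) (hn : j + n ≤ d - r) :
    x .f ^ n • y ≠ 0 := by
  induction n with
  | zero => simpa using h0
  | succ n ih =>
    push_cast at hn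
    intro h
    have h1 := (hy.f_pow_smul hx n).e_f_smul hx
    rw [← mul_smul (x .f), ← pow_succ', h, smul_zero] at h1
    exact (smul_ne_zero (casimirValue_sub_ne_zero (by omega) (by omega)) (ih (by omega))) h1.symm

/-- Outside the range from `r` to `d - r`, a Casimir polynomial with roots of index below `n ≤ r`
kills `y`, but the value of index `r` is not among its roots. -/
theorem eq_zero (hr : 2 * r ≤ d) (hj : j < r ∨ d - r < j) : y = 0 := by
  by_cases hw : j < 0 ∨ d < j
  · exact hx.eq_zero_of_weight hw hy.weight
  have key : ∃ n : ℕ, (n : ℤ) ≤ r ∧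
      aeval (QSchur.casimir d x) (∏ s ∈ Finset.range n, (X - C (casimirValue d s))) • y = 0 := by
    rcases hj with hj | hj
    · refine ⟨(j + 1).toNat, by omega, hx.aeval_casimir_prod_smul_left _ ?_⟩
      rw [hy.weight, Int.toNat_of_nonneg (by omega), add_sub_cancel_right]
    · refine ⟨(d + 1 - j).toNat, by omega, hx.aeval_casimir_prod_smul_right _ ?_⟩
      rw [hy.weight, Int.toNat_of_nonneg (by omega), sub_sub_cancel]
  obtain ⟨n, hn, h⟩ := key
  rw [aeval_smul_of_smul_eq hy.casimir, eval_prod] at h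
  refine (smul_eq_zero.mp h).resolve_left (Finset.prod_ne_zero_iff.mpr fun s hs => ?_)
  rw [eval_sub, eval_X, eval_C]
  have := Finset.mem_range.mp hs
  exact casimirValue_sub_ne_zero (by omega) (by omega)

end IsIsotypic

omit [IsScalarTower Qv A M] in
theorem IsIsotypic.prodMk {T : Type*} [AddCommGroup T] [Module Qv T] [Module A T]
    {d : ℕ} {x : PGen → A} {r j : ℤ} {y : M} {z : T}
    (hy : IsIsotypic d x r j y) (hz : IsIsotypic d x r j z) : IsIsotypic d x r j (y, z) :=
  ⟨Prod.ext hy.weight hz.weight, Prod.ext hy.casimir hz.casimir⟩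

omit [IsScalarTower Qv A M] in
theorem IsIsotypic.snd {T : Type*} [AddCommGroup T] [Module Qv T] [Module A T]
    {d : ℕ} {x : PGen → A} {r j : ℤ} {p : M × T}
    (hp : IsIsotypic d x r j p) : IsIsotypic d x r j p.2 :=
  ⟨congrArg Prod.snd hp.weight, congrArg Prod.snd hp.casimir⟩

/-! ### Comparison of an arbitrary module with one that contains highest weight vectors -/

/-- The vector of weight `j` obtained from the vector `p` of weight `i` by a power of `e` or of
`f`. -/
def ladder (x : PGen → A) (i : ℕ) (p : M) (j : ℕ) : M :=
  x .e ^ (i - j) • x .f ^ (j - i) • p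

variable {d : ℕ} {x : PGen → A} {r : ℤ} {i : ℕ} {p : M}

theorem isIsotypic_ladder (hx : IsPresented d x) (hp : IsIsotypic d x r i p) (j : ℕ) :
    IsIsotypic d x r j (ladder x i p j) := by
  have h := (hp.f_pow_smul hx (j - i)).e_pow_smul hx (i - j)
  rwa [show (i : ℤ) + (j - i : ℕ) - (i - j : ℕ) = j by omega] at h

theorem ladder_ne_zero (hx : IsPresented d x) (hp : IsIsotypic d x r i p) (h0 : p ≠ 0)
    (hi : r ≤ i ∧ i ≤ d - r) {j : ℕ} (hj : r ≤ j ∧ j ≤ d - r) : ladder x i p j ≠ 0 :=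
  (hp.f_pow_smul hx _).e_pow_smul_ne_zero hx
    (hp.f_pow_smul_ne_zero hx h0 hi.1 _ (by omega)) (by omega) _ (by omega)

/-- By truncated subtraction at most one exponent in `ladder` is nonzero. At weights up to `i` the
operator `e` extends the ladder; above `i` it undoes an `f` up to a scalar. -/
theorem e_smul_ladder_mem (hx : IsPresented d x) (hp : IsIsotypic d x r i p) (j : ℕ) :
    x .e • ladder x i p j ∈ Submodule.span Qv (Set.range (ladder x i p)) := by
  cases j with
  | zero =>
    rw [hx.eq_zero_of_weight (by simp) ((isIsotypic_ladder hx hp 0).e_smul hx).weight]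
    exact Submodule.zero_mem _
  | succ j =>
    by_cases h : j < i
    · refine Submodule.subset_span ⟨j, ?_⟩
      rw [ladder, ladder, ← mul_smul (x .e), ← pow_succ', show i - (j + 1) + 1 = i - j by omega,
        show j - i = 0 by omega, show j + 1 - i = 0 by omega]
    · have : x .e • ladder x i p (j + 1) =
          (casimirValue d r - casimirValue d (j + 1)) • ladder x i p j := by
        rw [← (isIsotypic_ladder hx hp j).e_f_smul hx, ladder, ladder,
          show i - (j + 1) = 0 by omega, show i - j = 0 by omega,
          show j + 1 - i = j - i + 1 by omega, pow_succ', mul_smul]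
        simp
      rw [this]
      exact Submodule.smul_mem _ _ (Submodule.subset_span ⟨j, rfl⟩)

theorem f_smul_ladder_mem (hx : IsPresented d x) (hp : IsIsotypic d x r i p) (j : ℕ) :
    x .f • ladder x i p j ∈ Submodule.span Qv (Set.range (ladder x i p)) := by
  by_cases h : i ≤ j
  · refine Submodule.subset_span ⟨j + 1, ?_⟩
    rw [ladder, ladder, show i - (j + 1) = 0 by omega, show i - j = 0 by omega,
      show j + 1 - i = j - i + 1 by omega, pow_succ', mul_smul]
    simp
  · have : x .f • ladder x i p j =
        (casimirValue d r - casimirValue d ((j + 1 : ℕ) : ℤ)) • ladder x i p (j + 1) := by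
      rw [← (isIsotypic_ladder hx hp (j + 1)).f_e_smul hx, ladder, ladder, ← mul_smul (x .e),
        ← pow_succ', show i - (j + 1) + 1 = i - j by omega,
        show j - i = 0 by omega, show j + 1 - i = 0 by omega]
    rw [this]
    exact Submodule.smul_mem _ _ (Submodule.subset_span ⟨j + 1, rfl⟩)

theorem smul_mem_span_ladder (hx : IsPresented d x) (hgen : Algebra.adjoin Qv (Set.range x) = ⊤)
    (hp : IsIsotypic d x r i p) (a : A) {y : M}
    (hy : y ∈ Submodule.span Qv (Set.range (ladder x i p))) :
    a • y ∈ Submodule.span Qv (Set.range (ladder x i p)) := by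
  have ha : a ∈ Algebra.adjoin Qv (Set.range x) := hgen ▸ Algebra.mem_top
  induction ha using Algebra.adjoin_induction generalizing y with
  | algebraMap c =>
    rw [algebraMap_smul]
    exact Submodule.smul_mem _ _ hy
  | add a b _ _ iha ihb =>
    rw [add_smul]
    exact Submodule.add_mem _ (iha hy) (ihb hy)
  | mul a b _ _ iha ihb =>
    rw [mul_smul]
    exact iha (ihb hy)
  | mem a ha =>
    obtain ⟨g, rfl⟩ := ha
    induction hy using Submodule.span_induction with
    | zero =>
      rw [smul_zero]
      exact Submodule.zero_mem _
    | add y z _ _ ihy ihz =>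
      rw [smul_add]
      exact Submodule.add_mem _ ihy ihz
    | smul c y _ ih =>
      rw [smul_comm]
      exact Submodule.smul_mem _ _ ih
    | mem y hy =>
      obtain ⟨j, rfl⟩ := hy
      cases g with
      | e => exact e_smul_ladder_mem hx hp j
      | f => exact f_smul_ladder_mem hx hp j
      | K₂ =>
        rw [(isIsotypic_ladder hx hp j).weight]
        exact Submodule.smul_mem _ _ (Submodule.subset_span ⟨j, rfl⟩)
      | K₂inv =>
        rw [hx.K₂inv_smul (isIsotypic_ladder hx hp j).weight]
        exact Submodule.smul_mem _ _ (Submodule.subset_span ⟨j, rfl⟩)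

variable {T : Type*} [AddCommGroup T] [Module Qv T] [Module A T] [IsScalarTower Qv A T]

/-- The diagonal argument: `(u, z)` generates a submodule of `M × T` with at most one dimension in
each weight, so what `a` does to `u` is controlled by what it does to `z`. -/
theorem smul_eq_zero_of_isIsotypic (hx : IsPresented d x)
    (hgen : Algebra.adjoin Qv (Set.range x) = ⊤) {r : ℕ} (hr : 2 * r ≤ d)
    {w : T} (hw : w ≠ 0) (hwt : x .K₂ • w = v ^ r • w) (hew : x .e • w = 0)
    {a : A} (ha : ∀ t : T, a • t = 0) (hi : r ≤ i ∧ i ≤ d - r) {u : M}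
    (hu : IsIsotypic d x r i u) : a • u = 0 := by
  rw [← zpow_natCast] at hwt
  have hw' : IsIsotypic d x r r w := by
    refine ⟨hwt, ?_⟩
    have := hx.f_e_smul hwt
    rwa [hew, smul_zero, eq_comm, sub_eq_zero] at this
  have hz : IsIsotypic d x r i (x .f ^ (i - r) • w) := by
    have := hw'.f_pow_smul hx (i - r)
    rwa [show (r : ℤ) + (i - r : ℕ) = i by omega] at this
  have hz0 : x .f ^ (i - r) • w ≠ 0 := hw'.f_pow_smul_ne_zero hx hw le_rfl _ (by omega)
  generalize x .f ^ (i - r) • w = z at hz hz0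
  have hp : IsIsotypic d x r i (u, z) := hu.prodMk hz
  let J := {j : ℕ // r ≤ j ∧ j ≤ d - r}
  -- Ladder vectors with weight outside the range from `r` to `d - r` vanish, so only the indices in
  -- `J` are needed.
  have hmem : a • (u, z) ∈ Submodule.span Qv
      (Set.range fun j : J => ladder x i (u, z) j) := by
    refine (Submodule.span_le.mpr ?_) (smul_mem_span_ladder hx hgen hp a
      (Submodule.subset_span ⟨i, by simp [ladder]⟩))
    rintro _ ⟨j, rfl⟩
    by_cases hj : r ≤ j ∧ j ≤ d - r
    · exact Submodule.subset_span ⟨⟨j, hj⟩, rfl⟩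
    · rw [(isIsotypic_ladder hx hp j).eq_zero hx (by omega) (by omega)]
      exact Submodule.zero_mem _
  rw [Finsupp.mem_span_range_iff_exists_finsupp] at hmem
  obtain ⟨c, hc⟩ := hmem
  -- The second components are nonzero eigenvectors of `K₂` with distinct eigenvalues.
  have hli : LinearIndependent Qv fun j : J => (ladder x i (u, z) j).2 := by
    refine Module.End.eigenvectors_linearIndependent' (Algebra.lsmul Qv Qv T (x .K₂))
      (fun j : J => v ^ ((j : ℕ) : ℤ)) (fun j k h => Subtype.ext (by
        exact_mod_cast v_zpow_injective h)) _ fun j => ⟨?_, ?_⟩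
    · rw [Module.End.mem_eigenspace_iff]
      exact (isIsotypic_ladder hx hp j).snd.weight
    · have : (ladder x i (u, z) j).2 = ladder x i z j := by simp [ladder]
      rw [this]
      have := j.2
      exact ladder_ne_zero hx hz hz0 (by omega) (by omega)
  have h2 : (Finsupp.linearCombination Qv fun j : J => (ladder x i (u, z) j).2) c = 0 := by
    have := congrArg (LinearMap.snd Qv M T) hc
    rw [Finsupp.sum, map_sum] at this
    rw [Finsupp.linearCombination_apply, Finsupp.sum]
    simpa [ha] using this
  have hc0 : c = 0 := (linearIndependent_iff.mp hli) c h2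
  have := congrArg Prod.fst hc
  rw [hc0, Finsupp.sum_zero_index] at this
  exact this.symm

theorem eq_zero_of_forall_smul_eq_zero (hx : IsPresented d x)
    (hgen : Algebra.adjoin Qv (Set.range x) = ⊤)
    (hw : ∀ r : ℕ, 2 * r ≤ d → ∃ w : T, w ≠ 0 ∧ x .K₂ • w = v ^ r • w ∧ x .e • w = 0)
    {a : A} (ha : ∀ t : T, a • t = 0) : a = 0 := by
  let N : Submodule Qv A := LinearMap.ker (Algebra.lsmul Qv Qv A a)
  suffices h : (1 : A) ∈ N by simpa [N] using h
  refine mem_of_prod_smul_eq_zero (x .K₂) (fun i : ℕ => v ^ i) ⊤ N (fun _ _ _ => trivial)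
    (Finset.range (d + 1)) (fun i _ j _ h => ?_) (fun i hi y _ hy => ?_) trivial ?_
  · exact_mod_cast v_zpow_injective (a₁ := (i : ℤ)) (a₂ := j) (by simpa using h)
  · rw [Finset.mem_range] at hi
    refine mem_of_prod_smul_eq_zero (casimir d x) (fun s : ℕ => casimirValue d s)
      (Module.End.eigenspace (Algebra.lsmul Qv Qv A (x .K₂)) (v ^ i)) N (fun q z hz => ?_)
      -- The shorter of the two annihilating products: its indices satisfy `s + t ≤ d`, so its roots
      -- are distinct, and each index `r` in it satisfies `r ≤ i ≤ d - r`.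
      (Finset.range (min i (d - i) + 1)) (fun s hs t ht h => ?_) (fun r hr u hu hcu => ?_)
      (y := y) ?_ ?_
    · rw [Module.End.mem_eigenspace_iff] at hz ⊢
      change x .K₂ • z = _ at hz
      change x .K₂ • aeval (casimir d x) q • z = _
      rw [← mul_smul, (commute_aeval hx.commute_casimir_K₂ q).eq, mul_smul, hz, smul_comm]
    · simp only [Finset.coe_range, Set.mem_Iio] at hs ht
      by_contra hst
      exact casimirValue_sub_ne_zero (by omega) (by omega) (sub_eq_zero.mpr h)
    · rw [Finset.mem_range] at hr
      obtain ⟨w, hw0, hwt, hew⟩ := hw r (by omega)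
      rw [Module.End.mem_eigenspace_iff, Algebra.lsmul_coe, ← zpow_natCast] at hu
      exact smul_eq_zero_of_isIsotypic hx hgen (by omega) hw0 hwt hew ha (by omega) ⟨hu, hcu⟩
    · rwa [Module.End.mem_eigenspace_iff]
    · rcases le_total i (d - i) with h | h
      · rw [min_eq_left h]
        exact hx.aeval_casimir_prod_smul_left _ (by simpa using hy)
      · rw [min_eq_right h]
        refine hx.aeval_casimir_prod_smul_right _ ?_
        rw [show (d : ℤ) + 1 - (d - i + 1 : ℕ) = i by omega, zpow_natCast]
        exact hy
  · have h := hx.prod_K₂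
    have hl : ∏ i ∈ Finset.range (d + 1), (X - C (v ^ i)) =
        ((List.range (d + 1)).map fun i => X - C (v ^ i)).prod := by
      simp [Finset.prod, Finset.range, Multiset.range]
    rw [smul_eq_mul, mul_one, hl, map_list_prod, List.map_map, ← h]
    congr 2
    funext i
    simp

end

/-! ### Tensor space -/

theorem rho_gen_single (g : GLGen) (j : Fin 2) :
    rho (U.gen g) (Pi.single j 1) = (natMat g).col j := by
  simp [rho, Matrix.toLinAlgEquiv'_apply]

theorem tensorRep_gen_tmul {M N : Type*} [AddCommGroup M] [Module Qv M] [AddCommGroup N]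
    [Module Qv N] (σ : U →ₐ[Qv] Module.End Qv M) (τ : U →ₐ[Qv] Module.End Qv N) (g : GLGen)
    (m : M) (n : N) :
    tensorRep σ τ (U.gen g) (m ⊗ₜ n) =
      (Module.endTensorEndAlgHom (R := Qv) (S := Qv) (A := Qv) (M := M) (N := N))
        (Algebra.TensorProduct.map σ τ (comulGen U.gen g)) (m ⊗ₜ n) := by
  have : Bialgebra.comulAlgHom Qv U (U.gen g) = comulGen U.gen g :=
    U.lift_gen (comulGen U.gen) U.isGL.comul g
  rw [← this]
  rfl

section
variable {M N : Type*} [AddCommGroup M] [Module Qv M] [AddCommGroup N] [Module Qv N]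
  (σ : U →ₐ[Qv] Module.End Qv M) (τ : U →ₐ[Qv] Module.End Qv N) (m : M) (n : N)

theorem tensorRep_e_tmul : tensorRep σ τ (U.gen .e) (m ⊗ₜ n) =
    σ (U.gen .e) m ⊗ₜ n + σ (U.gen .K₁) (σ (U.gen .K₂inv) m) ⊗ₜ τ (U.gen .e) n := by
  simp [tensorRep_gen_tmul, comulGen]
  rfl

theorem tensorRep_K₁_tmul : tensorRep σ τ (U.gen .K₁) (m ⊗ₜ n) =
    σ (U.gen .K₁) m ⊗ₜ τ (U.gen .K₁) n := by
  simp [tensorRep_gen_tmul, comulGen]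
  rfl

theorem tensorRep_K₂_tmul : tensorRep σ τ (U.gen .K₂) (m ⊗ₜ n) =
    σ (U.gen .K₂) m ⊗ₜ τ (U.gen .K₂) n := by
  simp [tensorRep_gen_tmul, comulGen]
  rfl

end

theorem rhoPow_succ_apply (d : ℕ) (a : U) (y : (⨂[Qv]^d E) ⊗[Qv] E) :
    rhoPow (d + 1) a (tensorPowSucc d y) = tensorPowSucc d (tensorRep (rhoPow d) rho a y) := by
  simp [rhoPow, LinearEquiv.conjAlgEquiv_apply]

/-- To check a property closed under sums on `E^{⊗(d+1)}` it is enough to check it on the products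
of a vector of `E^{⊗d}` and a standard basis vector of `E`. -/
theorem tensorPow_succ_induction {d : ℕ} {P : (⨂[Qv]^(d + 1) E) → Prop} (h0 : P 0)
    (hadd : ∀ y z, P y → P z → P (y + z))
    (h : ∀ (m : ⨂[Qv]^d E) (j : Fin 2), P (tensorPowSucc d (m ⊗ₜ Pi.single j 1)))
    (y : ⨂[Qv]^(d + 1) E) : P y := by
  obtain ⟨y, rfl⟩ := (tensorPowSucc d).surjective y
  induction y using TensorProduct.induction_on with
  | zero => rwa [map_zero]
  | add y z hy hz =>
    rw [map_add]
    exact hadd _ _ hy hz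
  | tmul m n =>
    have : m ⊗ₜ[Qv] n = (n 0 • m) ⊗ₜ Pi.single (0 : Fin 2) 1 +
        (n 1 • m) ⊗ₜ Pi.single (1 : Fin 2) 1 := by
      rw [TensorProduct.smul_tmul, TensorProduct.smul_tmul, ← TensorProduct.tmul_add]
      congr 1
      ext i
      fin_cases i <;> simp
    rw [this, map_add]
    exact hadd _ _ (h _ _) (h _ _)

theorem rho_K₁_single (j : Fin 2) :
    rho (U.gen .K₁) (Pi.single j 1) = v ^ (1 - (j : ℕ)) • Pi.single j 1 := by
  rw [rho_gen_single]
  ext i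
  fin_cases i <;> fin_cases j <;> simp [natMat]

theorem rho_K₂_single (j : Fin 2) :
    rho (U.gen .K₂) (Pi.single j 1) = v ^ (j : ℕ) • Pi.single j 1 := by
  rw [rho_gen_single]
  ext i
  fin_cases i <;> fin_cases j <;> simp [natMat]

theorem rho_e_single_zero : rho (U.gen .e) (Pi.single 0 1) = 0 := by
  rw [rho_gen_single]
  ext i
  fin_cases i <;> simp [natMat]

theorem rho_e_single_one : rho (U.gen .e) (Pi.single 1 1) = Pi.single 0 1 := by
  rw [rho_gen_single]
  ext i
  fin_cases i <;> simp [natMat]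

theorem rhoPow_zero_gen (g : GLGen) (y : ⨂[Qv]^0 E) :
    rhoPow 0 (U.gen g) y = counitGen g • y := by
  have : Bialgebra.counitAlgHom Qv U (U.gen g) = counitGen g :=
    U.lift_gen counitGen isGL_counitGen g
  rw [rhoPow, AlgHom.comp_apply, this]
  rfl

/-- `K₁` and `K₂` are group-like and their product is the scalar `v` on `E`, so every tensor factor
contributes one `v`. -/
theorem rhoPow_K₁_K₂ (d : ℕ) (y : ⨂[Qv]^d E) :
    rhoPow d (U.gen .K₁) (rhoPow d (U.gen .K₂) y) = v ^ d • y := by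
  induction d with
  | zero => simp [rhoPow_zero_gen, counitGen]
  | succ d ih =>
    induction y using tensorPow_succ_induction with
    | h0 => simp
    | hadd y z hy hz => simp only [map_add, hy, hz, smul_add]
    | h m j =>
      rw [rhoPow_succ_apply, rhoPow_succ_apply, tensorRep_K₂_tmul, tensorRep_K₁_tmul, ih,
        rho_K₂_single, map_smul, rho_K₁_single, smul_smul, ← pow_add,
        show (j : ℕ) + (1 - j) = 1 by omega, pow_one, ← TensorProduct.smul_tmul',
        TensorProduct.tmul_smul, smul_smul, ← pow_succ, map_smul]

theorem mem_span_weight (d : ℕ) (y : ⨂[Qv]^d E) :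
    y ∈ Submodule.span Qv {y | ∃ i ≤ d, rhoPow d (U.gen .K₂) y = v ^ i • y} := by
  induction d with
  | zero => exact Submodule.subset_span ⟨0, le_rfl, by simp [rhoPow_zero_gen, counitGen]⟩
  | succ d ih =>
    induction y using tensorPow_succ_induction with
    | h0 => exact Submodule.zero_mem _
    | hadd y z hy hz => exact Submodule.add_mem _ hy hz
    | h m j =>
      have hm := ih m
      induction hm using Submodule.span_induction with
      | zero => simp
      | add y z _ _ hy hz =>
        rw [TensorProduct.add_tmul, map_add]
        exact Submodule.add_mem _ hy hz
      | smul c y _ hy =>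
        rw [← TensorProduct.smul_tmul', map_smul]
        exact Submodule.smul_mem _ _ hy
      | mem y hy =>
        obtain ⟨i, hi, h⟩ := hy
        refine Submodule.subset_span ⟨i + j, by omega, ?_⟩
        rw [rhoPow_succ_apply, tensorRep_K₂_tmul, h, rho_K₂_single, ← TensorProduct.smul_tmul',
          TensorProduct.tmul_smul, smul_smul, ← pow_add, map_smul]

theorem rhoPow_prod_K₂ (d : ℕ) : ((List.range (d + 1)).map fun i =>
    rhoPow d (U.gen .K₂) - algebraMap Qv (Module.End Qv (⨂[Qv]^d E)) (v ^ i)).prod = 0 := by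
  refine LinearMap.ext fun y => ?_
  have hy := mem_span_weight d y
  induction hy using Submodule.span_induction with
  | zero => simp
  | add y z _ _ hy hz => rw [map_add, map_add, hy, hz]
  | smul c y _ hy => rw [map_smul, map_smul, hy]
  | mem y hy =>
    obtain ⟨i, hi, h⟩ := hy
    have key : ∀ l : List ℕ, (l.map fun i =>
        rhoPow d (U.gen .K₂) - algebraMap Qv (Module.End Qv (⨂[Qv]^d E)) (v ^ i)).prod y =
        (l.map fun k => v ^ i - v ^ k).prod • y := by
      intro l
      induction l with
      | nil => simp
      | cons a l ih =>
        have hs : (rhoPow d (U.gen .K₂) - algebraMap Qv (Module.End Qv (⨂[Qv]^d E)) (v ^ a)) y =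
            (v ^ i - v ^ a) • y := by
          rw [LinearMap.sub_apply, h]
          exact (sub_smul (v ^ i) (v ^ a) y).symm
        rw [List.map_cons, List.prod_cons, Module.End.mul_apply, ih, map_smul, hs, smul_smul,
          List.map_cons, List.prod_cons, mul_comm]
    rw [key, List.prod_eq_zero, zero_smul, LinearMap.zero_apply]
    exact List.mem_map.mpr ⟨i, List.mem_range.mpr (by omega), sub_self _⟩

theorem rhoPow_K₂inv {d : ℕ} {i : ℕ} {y : ⨂[Qv]^d E}
    (h : rhoPow d (U.gen .K₂) y = v ^ i • y) : rhoPow d (U.gen .K₂inv) y = (v ^ i)⁻¹ • y := by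
  have h1 : rhoPow d (U.gen .K₂inv) (rhoPow d (U.gen .K₂) y) = y := by
    rw [← Module.End.mul_apply, ← map_mul, U.isGL.K₂inv_K₂, map_one, Module.End.one_apply]
  rw [h, map_smul] at h1
  rwa [eq_inv_smul_iff₀ (pow_ne_zero _ v_ne_zero)]

theorem rhoPow_K₁ {d : ℕ} {i : ℕ} {y : ⨂[Qv]^d E}
    (h : rhoPow d (U.gen .K₂) y = v ^ i • y) :
    rhoPow d (U.gen .K₁) y = ((v ^ i)⁻¹ * v ^ d) • y := by
  have h1 := rhoPow_K₁_K₂ d y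
  rw [h, map_smul] at h1
  rwa [mul_smul, eq_inv_smul_iff₀ (pow_ne_zero _ v_ne_zero)]

theorem rhoPow_K₁inv {d : ℕ} {i : ℕ} {y : ⨂[Qv]^d E}
    (h : rhoPow d (U.gen .K₂) y = v ^ i • y) :
    rhoPow d (U.gen .K₁inv) y = ((v ^ i)⁻¹ * v ^ d)⁻¹ • y := by
  have h1 : rhoPow d (U.gen .K₁inv) (rhoPow d (U.gen .K₁) y) = y := by
    rw [← Module.End.mul_apply, ← map_mul, U.isGL.K₁inv_K₁, map_one, Module.End.one_apply]
  rw [rhoPow_K₁ h, map_smul] at h1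
  rwa [eq_inv_smul_iff₀ (mul_ne_zero (inv_ne_zero (pow_ne_zero _ v_ne_zero))
    (pow_ne_zero _ v_ne_zero))]

/-- Induction on `d`: tensoring on the right with the first basis vector of `E` preserves the weight
and the vanishing under `e`. This gives every `r` except in the middle case `2 * r = d + 1`, which
needs a correction term. -/
theorem exists_highest_weight_vector (d r : ℕ) (hr : 2 * r ≤ d) :
    ∃ w : ⨂[Qv]^d E, w ≠ 0 ∧ rhoPow d (U.gen .K₂) w = v ^ r • w ∧
      rhoPow d (U.gen .e) w = 0 := by
  have hv := v_ne_zero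
  induction d generalizing r with
  | zero =>
    obtain rfl : r = 0 := by omega
    refine ⟨(PiTensorProduct.isEmptyEquiv (R := Qv) (s := fun _ => E) (Fin 0)).symm 1, ?_, ?_, ?_⟩
    · rw [Ne, LinearEquiv.map_eq_zero_iff]
      exact one_ne_zero
    · simp [rhoPow_zero_gen, counitGen]
    · simp [rhoPow_zero_gen, counitGen]
  | succ d ih =>
    -- Coordinate projections on the last factor recover the two components.
    have tmul_single : ∀ (m m' : ⨂[Qv]^d E),
        m ⊗ₜ[Qv] (Pi.single 0 1 : E) + m' ⊗ₜ[Qv] (Pi.single 1 1 : E) = 0 → m = 0 ∧ m' = 0 := by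
      intro m m' h
      have h' : ∀ j : Fin 2, (TensorProduct.rid Qv _)
          ((LinearMap.proj j : E →ₗ[Qv] Qv).lTensor (⨂[Qv]^d E)
          (m ⊗ₜ[Qv] (Pi.single 0 1 : E) + m' ⊗ₜ[Qv] (Pi.single 1 1 : E))) = 0 := by
        intro j
        rw [h, map_zero, map_zero]
      exact ⟨by simpa using h' 0, by simpa using h' 1⟩
    by_cases hrd : 2 * r ≤ d
    · obtain ⟨w, hw, hwt, he⟩ := ih r hrd
      refine ⟨tensorPowSucc d (w ⊗ₜ Pi.single 0 1), ?_, ?_, ?_⟩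
      · rw [Ne, LinearEquiv.map_eq_zero_iff]
        exact fun h => hw (tmul_single w 0 (by simpa using h)).1
      · rw [rhoPow_succ_apply, tensorRep_K₂_tmul, hwt, rho_K₂_single]
        simp [← TensorProduct.smul_tmul']
      · rw [rhoPow_succ_apply, tensorRep_e_tmul, he, rho_e_single_zero]
        simp
    · obtain ⟨s, rfl⟩ : ∃ s, r = s + 1 := ⟨r - 1, by omega⟩
      obtain rfl : d = 2 * s + 1 := by omega
      obtain ⟨w, hw, hwt, he⟩ := ih s (by omega)
      have hf : rhoPow (2 * s + 1) (U.gen .K₂) (rhoPow (2 * s + 1) (U.gen .f) w) =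
          v ^ (s + 1) • rhoPow (2 * s + 1) (U.gen .f) w := by
        have h1 : U.gen .K₂ * U.gen .f = v • (U.gen .f * U.gen .K₂) := by
          rw [← smul_mul_assoc, ← U.isGL.K₂_f, mul_assoc _ _ (U.gen .K₂), U.isGL.K₂inv_K₂, mul_one]
        rw [← Module.End.mul_apply, ← map_mul, h1, map_smul, map_mul, LinearMap.smul_apply,
          Module.End.mul_apply, hwt, map_smul, smul_smul, pow_succ']
      -- The scalar is the quantum integer of `(2 * s + 1) - 2 * s = 1`, that is, `1`.
      have hef : rhoPow (2 * s + 1) (U.gen .e) (rhoPow (2 * s + 1) (U.gen .f) w) = w := by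
        have h1 := congrArg (fun a => rhoPow (2 * s + 1) a w) U.isGL.e_f
        simp only [map_sub, map_mul, map_smul, LinearMap.sub_apply, Module.End.mul_apply,
          LinearMap.smul_apply, he, map_zero, sub_zero, rhoPow_K₂inv hwt, rhoPow_K₁ hwt, hwt,
          rhoPow_K₁inv hwt, smul_smul, ← sub_smul] at h1
        rw [h1]
        conv_rhs => rw [← one_smul Qv w, ← inv_mul_cancel₀ v_sub_ne_zero]
        congr 2
        rw [pow_succ, pow_mul' v 2 s]
        field_simp
      -- Applying `e` to the first term gives `w ⊗ e₁`. On `w ⊗ e₂` it gives `v • (w ⊗ e₁)`, since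
      -- `K₁K₂⁻¹` acts on `w` by `v`; hence the coefficient `-v⁻¹`.
      refine ⟨tensorPowSucc _ (rhoPow _ (U.gen .f) w ⊗ₜ Pi.single 0 1 +
        (-v⁻¹) • w ⊗ₜ Pi.single 1 1), ?_, ?_, ?_⟩
      · rw [Ne, LinearEquiv.map_eq_zero_iff, TensorProduct.smul_tmul']
        intro h
        exact (smul_ne_zero (neg_ne_zero.mpr (inv_ne_zero hv)) hw) (tmul_single _ _ h).2
      · rw [rhoPow_succ_apply, map_add, map_smul, tensorRep_K₂_tmul, tensorRep_K₂_tmul, hwt, hf,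
          rho_K₂_single, rho_K₂_single]
        refine (congrArg _ ?_).trans (map_smul (tensorPowSucc _) _ _)
        simp only [← TensorProduct.smul_tmul', TensorProduct.tmul_smul, smul_add, smul_smul]
        congr 2
        · simp
        · simp
          ring
      · rw [rhoPow_succ_apply, map_add, map_smul, tensorRep_e_tmul, tensorRep_e_tmul, hef, he,
          rho_e_single_zero, rho_e_single_one, rhoPow_K₂inv hwt, map_smul, rhoPow_K₁ hwt]
        simp only [← TensorProduct.smul_tmul', TensorProduct.tmul_zero, TensorProduct.zero_tmul,
          add_zero, zero_add, smul_smul]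
        have : -v⁻¹ * ((v ^ s)⁻¹ * ((v ^ s)⁻¹ * v ^ (2 * s + 1))) = -1 := by
          rw [pow_succ, pow_mul' v 2 s]
          field_simp
        have hneg := (add_smul (1 : Qv) (-1) (w ⊗ₜ[Qv] (Pi.single 0 1 : E))).symm
        rw [one_smul, add_neg_cancel, zero_smul] at hneg
        rw [this, hneg, map_zero]

/-! ### The presented algebra -/

theorem Presented.isPresented (d : ℕ) : IsPresented d (Presented.gen d) := by
  constructor
  case prod_K₂ =>
    have h := RingQuot.mkAlgHom_rel Qv (PRel.prod_K₂ (d := d))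
    rw [map_zero, map_list_prod, List.map_map] at h
    rw [← h]
    congr 2
    funext i
    rw [Function.comp_apply, map_sub, AlgHom.commutes]
    rfl
  all_goals
    simp only [Presented.gen, ← map_mul, ← map_pow, ← map_sub, ← map_smul,
      ← map_one (RingQuot.mkAlgHom Qv (PRel d))]
    exact RingQuot.mkAlgHom_rel Qv (by constructor)

/-- The universal property of the presented algebra. -/
def Presented.lift {d : ℕ} {A : Type*} [Ring A] [Algebra Qv A] (x : PGen → A)
    (hx : IsPresented d x) : Presented d →ₐ[Qv] A :=
  RingQuot.liftAlgHom Qv ⟨FreeAlgebra.lift Qv x, by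
    intro a b h
    cases h with
    | prod_K₂ =>
      rw [map_zero, map_list_prod, List.map_map, ← hx.prod_K₂]
      congr 2
      funext i
      rw [Function.comp_apply, map_sub, AlgHom.commutes, FreeAlgebra.lift_ι_apply]
    | _ => simp [hx.K₂_K₂inv, hx.K₂inv_K₂, hx.K₂_e, hx.K₂_f, hx.e_f]⟩

@[simp]
theorem Presented.lift_gen {d : ℕ} {A : Type*} [Ring A] [Algebra Qv A] (x : PGen → A)
    (hx : IsPresented d x) (g : PGen) : Presented.lift x hx (Presented.gen d g) = x g := by
  simp [Presented.lift, Presented.gen]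

theorem Presented.adjoin_gen (d : ℕ) : Algebra.adjoin Qv (Set.range (Presented.gen d)) = ⊤ := by
  have h : Presented.gen d = RingQuot.mkAlgHom Qv (PRel d) ∘ FreeAlgebra.ι Qv := rfl
  rw [h, Set.range_comp, ← AlgHom.map_adjoin, FreeAlgebra.adjoin_range_ι, Algebra.map_top,
    AlgHom.range_eq_top]
  exact RingQuot.mkAlgHom_surjective Qv (PRel d)

/-- The generators `e, f, K₂, K₂⁻¹` of the presented algebra, in `U_v(𝔤𝔩₂)`. -/
def PGen.toGLGen : PGen → GLGen
  | .e => .e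
  | .f => .f
  | .K₂ => .K₂
  | .K₂inv => .K₂inv

theorem rhoPow_gen_K₁ (d : ℕ) : rhoPow d (U.gen .K₁) = v ^ d • rhoPow d (U.gen .K₂inv) := by
  have h : rhoPow d (U.gen .K₁) * rhoPow d (U.gen .K₂) = v ^ d • 1 :=
    LinearMap.ext (rhoPow_K₁_K₂ d)
  rw [← mul_one (rhoPow d (U.gen .K₁)), ← map_one (rhoPow d), ← U.isGL.K₂_K₂inv, map_mul,
    ← mul_assoc, h, smul_one_mul]

theorem rhoPow_gen_K₁inv (d : ℕ) :
    rhoPow d (U.gen .K₁inv) = (v ^ d)⁻¹ • rhoPow d (U.gen .K₂) := by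
  have hv : v ^ d ≠ 0 := pow_ne_zero _ v_ne_zero
  have h : rhoPow d (U.gen .K₁inv) * rhoPow d (U.gen .K₁) = 1 := by
    rw [← map_mul, U.isGL.K₁inv_K₁, map_one]
  rw [rhoPow_gen_K₁, mul_smul_comm] at h
  rw [eq_inv_smul_iff₀ hv, ← one_mul (rhoPow d (U.gen .K₂)), ← h, smul_mul_assoc, mul_assoc,
    ← map_mul, U.isGL.K₂inv_K₂, map_one, mul_one]

theorem isPresented_of_algHom {d : ℕ} {A : Type*} [Ring A] [Algebra Qv A] (ρ : U →ₐ[Qv] A)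
    (h₁ : ρ (U.gen .K₁) = v ^ d • ρ (U.gen .K₂inv))
    (h₂ : ρ (U.gen .K₁inv) = (v ^ d)⁻¹ • ρ (U.gen .K₂))
    (h : ((List.range (d + 1)).map fun i =>
      ρ (U.gen .K₂) - algebraMap Qv A (v ^ i)).prod = 0) :
    IsPresented d fun g => ρ (U.gen (PGen.toGLGen g)) where
  K₂_K₂inv := by simp only [PGen.toGLGen, ← map_mul, U.isGL.K₂_K₂inv, map_one]
  K₂inv_K₂ := by simp only [PGen.toGLGen, ← map_mul, U.isGL.K₂inv_K₂, map_one]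
  K₂_e := by simp only [PGen.toGLGen, ← map_mul, ← map_smul, U.isGL.K₂_e]
  K₂_f := by simp only [PGen.toGLGen, ← map_mul, ← map_smul, U.isGL.K₂_f]
  e_f := by
    simp only [PGen.toGLGen]
    rw [← map_mul, ← map_mul, ← map_sub, U.isGL.e_f, map_smul, map_sub, map_mul, map_mul,
      h₁, h₂, smul_mul_assoc, smul_mul_assoc, ← pow_two, ← pow_two]
  prod_K₂ := h

theorem isPresented_rhoPow (d : ℕ) :
    IsPresented d fun g => rhoPow d (U.gen (PGen.toGLGen g)) := by
  have h := isPresented_of_algHom (A := Module.End Qv (⨂[Qv]^d E)) (rhoPow d) (rhoPow_gen_K₁ d)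
    (rhoPow_gen_K₁inv d) (rhoPow_prod_K₂ d)
  exact h

/-- The representation of the presented algebra on tensor space. -/
def Presented.rep (d : ℕ) : Presented d →ₐ[Qv] Module.End Qv (⨂[Qv]^d E) :=
  Presented.lift _ (isPresented_rhoPow d)

theorem Presented.rep_gen (d : ℕ) (g : PGen) :
    Presented.rep d (Presented.gen d g) = rhoPow d (U.gen (PGen.toGLGen g)) :=
  Presented.lift_gen _ (isPresented_rhoPow d) g

theorem Presented.rep_mem_schur (d : ℕ) (a : Presented d) : Presented.rep d a ∈ Schur d := by
  have ha : a ∈ Algebra.adjoin Qv (Set.range (Presented.gen d)) :=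
    Presented.adjoin_gen d ▸ Algebra.mem_top
  refine (Algebra.adjoin_le (S := (Schur d).comap (Presented.rep d)) ?_) ha
  rintro _ ⟨g, rfl⟩
  exact ⟨_, (Presented.rep_gen d g).symm⟩

/-- The homomorphism from the presented algebra onto the quantum Schur algebra. -/
def presentedToSchur (d : ℕ) : Presented d →ₐ[Qv] Schur d :=
  (Presented.rep d).codRestrict (Schur d) (Presented.rep_mem_schur d)

theorem presentedToSchur_gen (d : ℕ) (g : PGen) :
    presentedToSchur d (Presented.gen d g) = toSchur d (U.gen (PGen.toGLGen g)) :=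
  Subtype.ext (Presented.rep_gen d g)

/-- Only `K₁^{±1}` lack a counterpart among the presented generators, and their images are scalar
multiples of those of `K₂^{∓1}`. -/
theorem rhoPow_mem_range_rep (d : ℕ) (a : U) : rhoPow d a ∈ (Presented.rep d).range := by
  let S := (Presented.rep d).range.comap (rhoPow d)
  change a ∈ S
  obtain ⟨a, rfl⟩ := RingQuot.mkAlgHom_surjective Qv GLRel a
  induction a using FreeAlgebra.induction with
  | grade0 c =>
    rw [AlgHom.commutes]
    exact S.algebraMap_mem c
  | mul a b ha hb =>
    rw [map_mul]
    exact S.mul_mem ha hb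
  | add a b ha hb =>
    rw [map_add]
    exact S.add_mem ha hb
  | grade1 g =>
    change rhoPow d (U.gen g) ∈ (Presented.rep d).range
    cases g with
    | e => exact ⟨_, Presented.rep_gen d .e⟩
    | f => exact ⟨_, Presented.rep_gen d .f⟩
    | K₂ => exact ⟨_, Presented.rep_gen d .K₂⟩
    | K₂inv => exact ⟨_, Presented.rep_gen d .K₂inv⟩
    | K₁ =>
      rw [rhoPow_gen_K₁]
      exact Subalgebra.smul_mem (Presented.rep d).range ⟨_, Presented.rep_gen d .K₂inv⟩ _
    | K₁inv =>
      rw [rhoPow_gen_K₁inv]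
      exact Subalgebra.smul_mem (Presented.rep d).range ⟨_, Presented.rep_gen d .K₂⟩ _

theorem presentedToSchur_surjective (d : ℕ) : Function.Surjective (presentedToSchur d) := by
  rintro ⟨_, a, rfl⟩
  obtain ⟨b, hb⟩ := rhoPow_mem_range_rep d a
  exact ⟨b, Subtype.ext hb⟩

theorem presentedToSchur_injective (d : ℕ) : Function.Injective (presentedToSchur d) := by
  rw [injective_iff_map_eq_zero]
  intro a ha
  -- With tensor space as a module through `Presented.rep`, lying in the kernel means annihilating
  -- every tensor.
  let : Module (Presented d) (⨂[Qv]^d E) := Module.compHom _ (Presented.rep d).toRingHom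
  have hsmul : ∀ (p : Presented d) (y : ⨂[Qv]^d E), p • y = Presented.rep d p y := fun _ _ => rfl
  have : IsScalarTower Qv (Presented d) (⨂[Qv]^d E) := ⟨fun c p y => by
    rw [hsmul, hsmul, map_smul, LinearMap.smul_apply]⟩
  refine eq_zero_of_forall_smul_eq_zero (T := ⨂[Qv]^d E) (Presented.isPresented d)
    (Presented.adjoin_gen d) (fun r hr => ?_) fun t => ?_
  · obtain ⟨w, hw, hwt, he⟩ := exists_highest_weight_vector d r hr
    refine ⟨w, hw, ?_, ?_⟩
    · rw [hsmul, Presented.rep_gen]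
      exact hwt
    · rw [hsmul, Presented.rep_gen]
      exact he
  · exact LinearMap.congr_fun (congrArg Subtype.val ha) t

end QSchur

end

/-- The quantum Schur algebra `S_v(2,d)` is isomorphic, as a `ℚ(v)`-algebra, to the presented
algebra, by an isomorphism that takes the generators to the elements of `S_v(2,d)` of the same
name and `v^d K₂⁻¹` to `K₁`. -/
theorem theorem2p3 (d : ℕ) :
    ∃ φ : QSchur.Presented d ≃ₐ[QSchur.Qv] QSchur.Schur d,
      φ (QSchur.Presented.gen d .e) = QSchur.toSchur d (QSchur.U.gen .e) ∧
      φ (QSchur.Presented.gen d .f) = QSchur.toSchur d (QSchur.U.gen .f) ∧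
      φ (QSchur.Presented.gen d .K₂) = QSchur.toSchur d (QSchur.U.gen .K₂) ∧
      φ (QSchur.Presented.gen d .K₂inv) = QSchur.toSchur d (QSchur.U.gen .K₂inv) ∧
      φ (QSchur.v ^ d • QSchur.Presented.gen d .K₂inv) = QSchur.toSchur d (QSchur.U.gen .K₁) := by
  refine ⟨AlgEquiv.ofBijective (QSchur.presentedToSchur d)
    ⟨QSchur.presentedToSchur_injective d, QSchur.presentedToSchur_surjective d⟩,
    QSchur.presentedToSchur_gen d .e, QSchur.presentedToSchur_gen d .f,
    QSchur.presentedToSchur_gen d .K₂, QSchur.presentedToSchur_gen d .K₂inv, ?_⟩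
  rw [map_smul]
  exact Subtype.ext ((congrArg _ (QSchur.Presented.rep_gen d .K₂inv)).trans
    (QSchur.rhoPow_gen_K₁ d).symm)
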